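/- Let $K$ be a field of characteristic $0$ and $V=K^2$ with basis $e_1,e_2$, with the symplectic form $\omega$, $\omega(e_1,e_2)=1=-\omega(e_2,e_1)$, and the inverse form on $V^*$, $\Omega=\omega^{-1}=\left[\begin{smallmatrix}0&-1\\1&0\end{smallmatrix}\right]$. A spin network is a drawing of a trivalent graph whose edges carry labels in $\mathbb N$ such that the labels $a,b,c$ at each vertex are *admissible*: $a+b+c$ is even and $a,b,c\le (a+b+c)/2$. A network, or a fragment of one with open ends at the bottom and the top of the page, is evaluated (read upwards) as a tensor: an edge labelled $n$ stands for $n$ strands carrying the symmetrizer $\frac1{n!}\sum_{\sigma\in S_n}\sigma$ of $V^{\otimes n}$; at a vertex the strands of the three edges are joined without intersections; a maximum of a strand is $\omega$, a minimum is $\Omega$, and a crossing is $v\otimes w\mapsto w\otimes v$. For a closed network $G$ the result is a number, the chromatic evaluation $\langle G\rangle$. Let $\theta(a,b,c)$ be the chromatic evaluation of the network with two vertices joined by three edges $a,b,c$ (drawn in the plane without crossings), and $\mathrm{Tet}\left[\begin{smallmatrix}A&B&C\\a&b&c\end{smallmatrix}\right]$ that of the planar tetrahedral network with vertices $\{a,b,c\},\{a,B,C\},\{A,b,C\},\{A,B,c\}$.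 **Proposition.** Let $(a,b,c)$, $(a,B,C)$, $(A,b,C)$, $(A,B,c)$ be admissible. Consider the triangular fragment with external edges $a$ (lower left), $b$ (lower right), $c$ (top) and with sides $A$, $B$, $C$ opposite to $a$, $b$, $c$ respectively (so $C$ is the lower bar, and the three vertices are $\{a,B,C\},\{A,b,C\},\{A,B,c\}$). Then $\theta(a,b,c)\neq0$, and the triangular fragment equals, as a tensor $V^{\otimes a}\otimes V^{\otimes b}\to V^{\otimes c}$, the single trivalent vertex with edges $a$, $b$ below and $c$ above, times the scalar $$\frac{\mathrm{Tet}\begin{bmatrix}A&B&C\\a&b&c\end{bmatrix}}{\theta(a,b,c)}.$$ Consequently, if $N$ is a closed spin network that contains this fragment and $N'$ is obtained from $N$ by replacing the fragment by the single vertex, then $\langle N\rangle=\dfrac{\mathrm{Tet}\left[\begin{smallmatrix}A&B&C\\a&b&c\end{smallmatrix}\right]}{\theta(a,b,c)}\,\langle N'\rangle$. -/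

import Mathlib

/-!
Spin networks are drawn on a page that is oriented upwards, in the spinor calculus of a
two-dimensional space with a symplectic basis `e 0, e 1`. A drawing with open ends at the bottom
and at the top is read from the bottom to the top, as a tensor; a closed drawing is a number.
-/

namespace SpinNetwork

/-- The symplectic form `ω` on the spinor space, in a symplectic basis: `ω (e 0, e 1) = 1`. -/
def omega (K : Type*) [Field K] : Matrix (Fin 2) (Fin 2) K := !![0, 1; -1, 0]

/-- The inner product `Ω = ω⁻¹` of the dual spinor space, in the dual basis. -/
def Omega (K : Type*) [Field K] : Matrix (Fin 2) (Fin 2) K := !![0, -1; 1, 0]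

/-- The matrices `ω` and `Ω` are inverse to each other (a wavy line may be straightened). -/
theorem omega_mul_Omega (K : Type*) [Field K] : omega K * Omega K = 1 := by
  ext i j
  fin_cases i <;> fin_cases j <;> simp [omega, Omega, Matrix.mul_apply, Fin.sum_univ_two]

/-- The identity tensor, the value of a single vertical strand. -/
def delta (K : Type*) [Field K] : Matrix (Fin 2) (Fin 2) K := 1

/-- The condition on the labels of the three edges that meet at a vertex. -/
structure Admissible (a b c : ℕ) : Prop where
  even : Even (a + b + c)
  le₁ : a ≤ (a + b + c) / 2
  le₂ : b ≤ (a + b + c) / 2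
  le₃ : c ≤ (a + b + c) / 2

/-- The number of strands that run between the edges labelled `a` and `b` at a vertex with labels
`a`, `b`, `c`. -/
def strands (a b c : ℕ) : ℕ := (a + b - c) / 2

theorem Admissible.eq₁ {a b c : ℕ} (h : Admissible a b c) :
    strands a c b + strands a b c = a := by
  obtain ⟨⟨m, hm⟩, h1, h2, h3⟩ := h
  unfold strands
  omega

theorem Admissible.eq₂ {a b c : ℕ} (h : Admissible a b c) :
    strands a b c + strands b c a = b := by
  obtain ⟨⟨m, hm⟩, h1, h2, h3⟩ := h
  unfold strands
  omega

theorem Admissible.eq₃ {a b c : ℕ} (h : Admissible a b c) :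
    strands a c b + strands b c a = c := by
  obtain ⟨⟨m, hm⟩, h1, h2, h3⟩ := h
  unfold strands
  omega

/-- Drawings of (pieces of) spin networks. `Net l m` consists of the drawings whose edges leaving
the page at the bottom carry, from left to right, the labels in the list `l`, and whose edges
leaving the page at the top carry the labels in `m`. Closed networks are the elements of
`Net [] []`. -/
inductive Net : List ℕ → List ℕ → Type
  /-- parallel vertical edges -/
  | edges (l : List ℕ) : Net l l
  /-- an edge that makes a minimum -/
  | cup (a : ℕ) : Net [] [a, a]
  /-- an edge that makes a maximum -/
  | cap (a : ℕ) : Net [a, a] []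
  /-- two edges that cross -/
  | cross (a b : ℕ) : Net [a, b] [b, a]
  /-- a vertex with the edges `a`, `b` below it and the edge `c` above it -/
  | merge (a b c : ℕ) (h : Admissible a b c) : Net [a, b] [c]
  /-- a vertex with the edge `c` below it and the edges `a`, `b` above it -/
  | split (a b c : ℕ) (h : Admissible a b c) : Net [c] [a, b]
  /-- the second drawing put on top of the first -/
  | stack {l m n : List ℕ} (lower : Net l m) (upper : Net m n) : Net l n
  /-- the second drawing put to the right of the first -/
  | beside {l m l' m' : List ℕ} (left : Net l m) (right : Net l' m') : Net (l ++ l') (m ++ m')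

/-- The basis states of the strands of a row of edges: an edge with label `a` has `a` strands, each
of which carries a spinor index. -/
def State : List ℕ → Type
  | [] => Unit
  | a :: l => (Fin a → Fin 2) × State l

instance State.instFintype : (l : List ℕ) → Fintype (State l)
  | [] => inferInstanceAs (Fintype Unit)
  | a :: l =>
    letI := State.instFintype l
    inferInstanceAs (Fintype ((Fin a → Fin 2) × State l))

/-- The restriction of a state to the edges on the left. -/
def State.left : (l l' : List ℕ) → State (l ++ l') → State l
  | [], _, _ => ()
  | _ :: l, l', s => (s.1, State.left l l' s.2)

/-- The restriction of a state to the edges on the right. -/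
def State.right : (l l' : List ℕ) → State (l ++ l') → State l'
  | [], _, s => s
  | _ :: l, l', s => State.right l l' s.2

section Evaluation

variable (K : Type*) [Field K]

/-- The symmetrizing tensor on `n` strands, the average of all permutations of the strands. -/
def symmetrizer (n : ℕ) : Matrix (Fin n → Fin 2) (Fin n → Fin 2) K :=
  fun s t => (n.factorial : K)⁻¹ *
    ∑ σ : Equiv.Perm (Fin n), if t = s ∘ σ then 1 else 0

/-- The value of parallel vertical edges: a symmetrizing tensor on each edge. -/
def edgesValue : (l : List ℕ) → Matrix (State l) (State l) K
  | [] => fun _ _ => 1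
  | a :: l => fun s t => symmetrizer K a s.1 t.1 * edgesValue l s.2 t.2

/-- The `a` nested half-circles of a minimum, each of them being `Ω`. -/
def cupStrands (a : ℕ) : Matrix (State []) (State [a, a]) K :=
  fun _ t => ∏ x : Fin a, Omega K (t.1 x) (t.2.1 x.rev)

/-- The `a` nested half-circles of a maximum, each of them being `ω`. -/
def capStrands (a : ℕ) : Matrix (State [a, a]) (State []) K :=
  fun s _ => ∏ x : Fin a, omega K (s.1 x) (s.2.1 x.rev)

/-- The strands of an edge cross the strands of another one. -/
def crossStrands (a b : ℕ) : Matrix (State [a, b]) (State [b, a]) K :=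
  fun s t => (∏ x : Fin a, delta K (s.1 x) (t.2.1 x)) * ∏ y : Fin b, delta K (s.2.1 y) (t.1 y)

/-- The non-intersecting connection of the strands at a vertex. The first `strands a c b` strands
of `a` are the first strands of `c`, the last `strands b c a` strands of `b` are the last strands
of `c`, and the other strands of `a` and `b` are joined by nested half-circles, which are given by
the matrix `M`. -/
def vertexStrands (M : Matrix (Fin 2) (Fin 2) K) {a b c : ℕ} (h : Admissible a b c)
    (u : Fin a → Fin 2) (v : Fin b → Fin 2) (w : Fin c → Fin 2) : K :=
  (∏ x : Fin (strands a c b),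
      delta K (u (Fin.cast h.eq₁ (Fin.castAdd _ x))) (w (Fin.cast h.eq₃ (Fin.castAdd _ x)))) *
  (∏ y : Fin (strands b c a),
      delta K (v (Fin.cast h.eq₂ (Fin.natAdd _ y))) (w (Fin.cast h.eq₃ (Fin.natAdd _ y)))) *
  ∏ z : Fin (strands a b c),
      M (u (Fin.cast h.eq₁ (Fin.natAdd _ z))) (v (Fin.cast h.eq₂ (Fin.castAdd _ z.rev)))

/-- The strands at a vertex with the edges `a`, `b` below it: the half-circles are maxima. -/
def mergeStrands {a b c : ℕ} (h : Admissible a b c) : Matrix (State [a, b]) (State [c]) K :=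
  fun s t => vertexStrands K (omega K) h s.1 s.2.1 t.1

/-- The strands at a vertex with the edges `a`, `b` above it: the half-circles are minima. -/
def splitStrands {a b c : ℕ} (h : Admissible a b c) : Matrix (State [c]) (State [a, b]) K :=
  fun s t => vertexStrands K (Omega K) h t.1 t.2.1 s.1

/-- The tensor of a drawing. Its rows are indexed by the states of the edges at the bottom, its
columns by the states of the edges at the top. Every edge carries a symmetrizing tensor. -/
def Net.eval : {l m : List ℕ} → Net l m → Matrix (State l) (State m) K
  | _, _, .edges l => edgesValue K l
  | _, _, .cup a => cupStrands K a * edgesValue K [a, a]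
  | _, _, .cap a => edgesValue K [a, a] * capStrands K a
  | _, _, .cross a b => edgesValue K [a, b] * crossStrands K a b * edgesValue K [b, a]
  | _, _, .merge a b c h =>
      edgesValue K [a, b] * mergeStrands K h * edgesValue K [c]
  | _, _, .split a b c h =>
      edgesValue K [c] * splitStrands K h * edgesValue K [a, b]
  | _, _, .stack lower upper => Net.eval lower * Net.eval upper
  | _, _, .beside (l := l) (m := m) (l' := l') (m' := m') left right => fun s t =>
      Net.eval left (State.left l l' s) (State.left m m' t) *
        Net.eval right (State.right l l' s) (State.right m m' t)

/-- The chromatic evaluation of a closed spin network. -/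
def Net.chromatic (G : Net [] []) : K := G.eval K () ()

end Evaluation

/-- The theta network: two vertices, joined by three edges with labels `a`, `b`, `c`. The edge `c`
goes from the upper vertex around the right side of the page to the lower vertex. -/
def thetaNet (a b c : ℕ) (h : Admissible a b c) : Net [] [] :=
  .stack (.cup c) <|
  .stack (.beside (.split a b c h) (.edges [c]) : Net [c, c] [a, b, c]) <|
  .stack (.beside (.merge a b c h) (.edges [c]) : Net [a, b, c] [c, c]) <|
  .cap c

/-- The triangular fragment: two external edges `a` (left) and `b` (right) leave it at the bottom,
the external edge `c` leaves it at the top. The sides of the triangle opposite to the external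
edges `a`, `b`, `c` have the labels `A` (right side), `B` (left side) and `C` (lower bar), so the
three vertices carry the labels `a, B, C`, then `A, b, C` and `A, B, c`. -/
def triangleNet (a b c A B C : ℕ) (ha : Admissible a B C) (hb : Admissible A b C)
    (hc : Admissible A B c) : Net [a, b] [c] :=
  .stack (.beside (.split B C a (by
    obtain ⟨⟨m, hm⟩, h1, h2, h3⟩ := ha; exact ⟨⟨m, by omega⟩, by omega, by omega, by omega⟩))
    (.edges [b]) : Net [a, b] [B, C, b]) <|
  .stack (.beside (.edges [B]) (.merge C b A (by
    obtain ⟨⟨m, hm⟩, h1, h2, h3⟩ := hb; exact ⟨⟨m, by omega⟩, by omega, by omega, by omega⟩)) :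
    Net [B, C, b] [B, A]) <|
  .merge B A c (by
    obtain ⟨⟨m, hm⟩, h1, h2, h3⟩ := hc; exact ⟨⟨m, by omega⟩, by omega, by omega, by omega⟩)

/-- The tetrahedral network with the pairs of opposite edges `A, a`, then `B, b` and `C, c`, whose
vertices carry the labels `a, b, c`, then `a, B, C`, then `A, b, C` and `A, B, c`. It is drawn with
the vertex `a, b, c` at the bottom and the edge `c` around the right side of the page. -/
def tetNet (A B C a b c : ℕ) (h : Admissible a b c) (ha : Admissible a B C)
    (hb : Admissible A b C) (hc : Admissible A B c) : Net [] [] :=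
  .stack (.cup c) <|
  .stack (.beside (.split a b c h) (.edges [c]) : Net [c, c] [a, b, c]) <|
  .stack (.beside (triangleNet a b c A B C ha hb hc) (.edges [c]) : Net [a, b, c] [c, c]) <|
  .cap c

end SpinNetwork

/-! The argument is Schur's lemma for `SL₂`, made explicit. As `ω` is `SL₂`-invariant, vertices, and
hence the triangle, are equivariant, and every drawing absorbs symmetrizers at its ends. It suffices
that the equivariant maps from `Sym^a V ⊗ Sym^b V` to `Sym^c V` form the line spanned by the vertex
(`IsInvariant.exists_eq_smul_merge`).

For this, such a tensor is shown to be determined by one component with inputs `e 0 ^ a` and `e 1 ^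
b` (`eq_zero_of_invariant`). The diagonal torus kills the outputs of the wrong weight; `SL₂` moves
the pair `e 0`, `e 1` to multiples of `(1, α)`, `(1, β)` for any `α ≠ β`; and powers of such vectors
detect symmetric tensors. For the vertex, this component is nonzero.

So the triangle is `k` times the vertex. Closing both in the same way gives `Tet = k * θ`, and `k`
is the asserted quotient once `θ ≠ 0`. Up to sign a split is the transpose of a merge and closing an
edge is a trace, so `θ` is, up to sign, the sum of the squares of the entries of the vertex. These
are rational, and one is nonzero, so the sum is positive in `ℚ`. -/

namespace SpinNetwork

open Matrix Kronecker

/-! ### Juxtaposition of tensors -/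

/-- Juxtaposition of states. -/
def State.append : (l l' : List ℕ) → State l → State l' → State (l ++ l')
  | [], _, _, t => t
  | _ :: l, l', s, t => (s.1, State.append l l' s.2 t)

/-- A state of a row of edges is a state of the edges on the left and one of those on the right. -/
def State.appendEquiv : (l l' : List ℕ) → State (l ++ l') ≃ State l × State l'
  | l, l' =>
  { toFun := fun s => (State.left l l' s, State.right l l' s)
    invFun := fun p => State.append l l' p.1 p.2
    left_inv := by
      induction l with
      | nil => intro s; rfl
      | cons a l ih => intro s; exact Prod.ext rfl (ih s.2)
    right_inv := by
      induction l with
      | nil => intro p; rfl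
      | cons a l ih =>
        rintro ⟨s, t⟩
        have h := ih (s.2, t)
        simp only [Prod.mk.injEq] at h ⊢
        exact ⟨Prod.ext rfl h.1, h.2⟩ }

instance State.instUniqueNil : Unique (State []) := inferInstanceAs (Unique Unit)

instance State.instDecidableEqNil : DecidableEq (State []) := inferInstanceAs (DecidableEq Unit)

section

variable {K : Type*} [Field K]

/-- The tensor of two tensors put side by side. -/
def juxtapose {l m l' m' : List ℕ} (A : Matrix (State l) (State m) K)
    (B : Matrix (State l') (State m') K) : Matrix (State (l ++ l')) (State (m ++ m')) K :=
  (A ⊗ₖ B).submatrix (State.appendEquiv l l') (State.appendEquiv m m')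

theorem eval_beside {l m l' m' : List ℕ} (X : Net l m) (Y : Net l' m') :
    (Net.beside X Y).eval K = juxtapose (X.eval K) (Y.eval K) := rfl

/-- The interchange law for stacking and juxtaposing, inherited from the Kronecker product. -/
theorem juxtapose_mul {l m n l' m' n' : List ℕ} (A : Matrix (State l) (State m) K)
    (B : Matrix (State l') (State m') K) (C : Matrix (State m) (State n) K)
    (D : Matrix (State m') (State n') K) :
    juxtapose A B * juxtapose C D = juxtapose (A * C) (B * D) := by
  unfold juxtapose
  rw [Matrix.submatrix_mul_equiv, ← Matrix.mul_kronecker_mul]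

theorem juxtapose_smul_left {l m l' m' : List ℕ} (k : K) (A : Matrix (State l) (State m) K)
    (B : Matrix (State l') (State m') K) : juxtapose (k • A) B = k • juxtapose A B := by
  ext s t
  simp [juxtapose, mul_assoc]

theorem juxtapose_smul_right {l m l' m' : List ℕ} (k : K) (A : Matrix (State l) (State m) K)
    (B : Matrix (State l') (State m') K) : juxtapose A (k • B) = k • juxtapose A B := by
  ext s t
  simp [juxtapose, mul_left_comm]

theorem edgesValue_append (l l' : List ℕ) :
    edgesValue K (l ++ l') = juxtapose (edgesValue K l) (edgesValue K l') := by
  induction l with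
  | nil =>
    ext s t
    exact (one_mul _).symm
  | cons a l ih =>
    ext s t
    have h := congrFun (congrFun ih s.2) t.2
    exact (congrArg _ h).trans (mul_assoc _ _ _).symm

/-! ### Tensor powers and symmetrizers -/

/-- The tensor power of a matrix that acts on the strands of an edge. -/
def strandPower (g : Matrix (Fin 2) (Fin 2) K) (n : ℕ) :
    Matrix (Fin n → Fin 2) (Fin n → Fin 2) K :=
  fun s t => ∏ x, g (s x) (t x)

theorem strandPower_mul (g h : Matrix (Fin 2) (Fin 2) K) (n : ℕ) :
    strandPower g n * strandPower h n = strandPower (g * h) n := by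
  ext s t
  simp only [strandPower, Matrix.mul_apply, Finset.prod_univ_sum, Fintype.piFinset_univ,
    Finset.prod_mul_distrib]

theorem strandPower_one (n : ℕ) : strandPower (1 : Matrix (Fin 2) (Fin 2) K) n = 1 := by
  ext s t
  simp only [strandPower, Matrix.one_apply, Finset.prod_ite_zero, Finset.prod_const_one,
    funext_iff, Finset.mem_univ, true_implies]

theorem strandPower_transpose (g : Matrix (Fin 2) (Fin 2) K) (n : ℕ) :
    (strandPower g n)ᵀ = strandPower gᵀ n := rfl

theorem strandPower_comp (g : Matrix (Fin 2) (Fin 2) K) {n : ℕ} (σ : Equiv.Perm (Fin n))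
    (s t : Fin n → Fin 2) : strandPower g n (s ∘ σ) (t ∘ σ) = strandPower g n s t :=
  Equiv.prod_comp σ fun x => g (s x) (t x)

/-- The tensor power of a matrix that acts on all strands of a row of edges. -/
def rowPower (g : Matrix (Fin 2) (Fin 2) K) : (l : List ℕ) → Matrix (State l) (State l) K
  | [] => fun _ _ => 1
  | a :: l => fun s t => strandPower g a s.1 t.1 * rowPower g l s.2 t.2

theorem rowPower_append (g : Matrix (Fin 2) (Fin 2) K) (l l' : List ℕ) :
    rowPower g (l ++ l') = juxtapose (rowPower g l) (rowPower g l') := by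
  induction l with
  | nil =>
    ext s t
    exact (one_mul _).symm
  | cons a l ih =>
    ext s t
    have h := congrFun (congrFun ih s.2) t.2
    exact (congrArg _ h).trans (mul_assoc _ _ _).symm

theorem rowPower_transpose (g : Matrix (Fin 2) (Fin 2) K) (l : List ℕ) :
    (rowPower g l)ᵀ = rowPower gᵀ l := by
  induction l with
  | nil => rfl
  | cons a l ih =>
    ext s t
    exact congrArg _ (congrFun (congrFun ih s.2) t.2)

theorem mul_symmetrizer_apply {ι : Type*} {n : ℕ} (A : Matrix ι (Fin n → Fin 2) K) (i : ι)
    (t : Fin n → Fin 2) :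
    (A * symmetrizer K n) i t =
      (n.factorial : K)⁻¹ * ∑ σ : Equiv.Perm (Fin n), A i (t ∘ σ) := by
  simp only [Matrix.mul_apply, symmetrizer, Finset.mul_sum]
  -- With `σ⁻¹` in place of `σ`, the only surviving intermediate state is `t ∘ σ`.
  rw [Finset.sum_comm, ← Equiv.sum_comp (Equiv.inv (Equiv.Perm (Fin n)))]
  refine Finset.sum_congr rfl fun σ _ => ?_
  rw [Finset.sum_eq_single (t ∘ σ)]
  · have : t = (t ∘ σ) ∘ (σ⁻¹ : Equiv.Perm (Fin n)) := by ext x; simp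
    simp only [Equiv.inv_apply]
    rw [if_pos this]
    ring
  · intro u _ hu
    rw [if_neg, mul_zero, mul_zero]
    rintro rfl
    exact hu (by ext x; simp)
  · simp

theorem symmetrizer_transpose (n : ℕ) : (symmetrizer K n)ᵀ = symmetrizer K n := by
  ext s t
  simp only [Matrix.transpose_apply, symmetrizer]
  rw [← Equiv.sum_comp (Equiv.inv (Equiv.Perm (Fin n)))]
  congr 1
  refine Finset.sum_congr rfl fun σ _ => if_congr ?_ rfl rfl
  constructor
  · rintro rfl
    ext x; simp
  · rintro rfl
    ext x; simp

theorem symmetrizer_comp_right {n : ℕ} (s t : Fin n → Fin 2) (σ : Equiv.Perm (Fin n)) :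
    symmetrizer K n s (t ∘ σ) = symmetrizer K n s t := by
  simp only [symmetrizer]
  rw [← Equiv.sum_comp (Equiv.mulRight σ)]
  congr 1
  refine Finset.sum_congr rfl fun τ _ => if_congr ?_ rfl rfl
  rw [Equiv.coe_mulRight, Equiv.Perm.coe_mul, ← Function.comp_assoc]
  exact σ.surjective.injective_comp_right.eq_iff

theorem symmetrizer_mul_self [CharZero K] (n : ℕ) :
    symmetrizer K n * symmetrizer K n = symmetrizer K n := by
  ext s t
  rw [mul_symmetrizer_apply]
  simp only [symmetrizer_comp_right, Finset.sum_const, Finset.card_univ, Fintype.card_perm,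
    Fintype.card_fin, nsmul_eq_mul]
  rw [inv_mul_cancel_left₀ (Nat.cast_ne_zero.2 n.factorial_ne_zero)]

/-- Permuting strands commutes with applying the same `g` to each. Transposition turns the product
with the symmetrizer on the left into one with it on the right, so `mul_symmetrizer_apply` covers
both sides. -/
theorem strandPower_mul_symmetrizer (g : Matrix (Fin 2) (Fin 2) K) (n : ℕ) :
    strandPower g n * symmetrizer K n = symmetrizer K n * strandPower g n := by
  have h : ∀ g : Matrix (Fin 2) (Fin 2) K,
      symmetrizer K n * strandPower g n = (strandPower gᵀ n * symmetrizer K n)ᵀ := fun g => by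
    rw [Matrix.transpose_mul, symmetrizer_transpose, strandPower_transpose,
      Matrix.transpose_transpose]
  rw [h]
  ext s t
  rw [Matrix.transpose_apply, mul_symmetrizer_apply, mul_symmetrizer_apply,
    ← Equiv.sum_comp (Equiv.inv (Equiv.Perm (Fin n)))]
  congr 1
  refine Finset.sum_congr rfl fun σ _ => ?_
  rw [← strandPower_comp g σ, ← strandPower_transpose, Matrix.transpose_apply]
  congr 1
  ext x; simp

theorem edgesValue_transpose (l : List ℕ) : (edgesValue K l)ᵀ = edgesValue K l := by
  induction l with
  | nil => rfl
  | cons a l ih =>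
    ext s t
    exact congrArg₂ (· * ·) (congrFun (congrFun (symmetrizer_transpose a) s.1) t.1)
      (congrFun (congrFun ih s.2) t.2)

theorem edgesValue_nil : edgesValue K [] = 1 := by
  ext s t
  rw [Subsingleton.elim s t, Matrix.one_apply_eq]
  rfl

/-- The tensor of an edge tensor to the left of the tensor of a row of edges. -/
def consMatrix {a b : ℕ} {l m : List ℕ} (A : Matrix (Fin a → Fin 2) (Fin b → Fin 2) K)
    (B : Matrix (State l) (State m) K) : Matrix (State (a :: l)) (State (b :: m)) K :=
  A ⊗ₖ B

theorem edgesValue_cons (a : ℕ) (l : List ℕ) :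
    edgesValue K (a :: l) = consMatrix (symmetrizer K a) (edgesValue K l) := rfl

theorem rowPower_cons (g : Matrix (Fin 2) (Fin 2) K) (a : ℕ) (l : List ℕ) :
    rowPower g (a :: l) = consMatrix (strandPower g a) (rowPower g l) := rfl

theorem consMatrix_mul {a b c : ℕ} {l m n : List ℕ}
    (A : Matrix (Fin a → Fin 2) (Fin b → Fin 2) K) (B : Matrix (State l) (State m) K)
    (C : Matrix (Fin b → Fin 2) (Fin c → Fin 2) K) (D : Matrix (State m) (State n) K) :
    consMatrix A B * consMatrix C D = consMatrix (A * C) (B * D) :=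
  (Matrix.mul_kronecker_mul A C B D).symm

theorem edgesValue_mul_self [CharZero K] (l : List ℕ) :
    edgesValue K l * edgesValue K l = edgesValue K l := by
  induction l with
  | nil => rw [edgesValue_nil, Matrix.one_mul]
  | cons a l ih => rw [edgesValue_cons, consMatrix_mul, ih, symmetrizer_mul_self]

theorem rowPower_mul_edgesValue (g : Matrix (Fin 2) (Fin 2) K) (l : List ℕ) :
    rowPower g l * edgesValue K l = edgesValue K l * rowPower g l := by
  induction l with
  | nil => rw [edgesValue_nil, Matrix.one_mul, Matrix.mul_one]
  | cons a l ih =>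
    rw [edgesValue_cons, rowPower_cons, consMatrix_mul, consMatrix_mul, ih,
      strandPower_mul_symmetrizer]

/-- Each generator carries symmetrizers at its open ends, and these are idempotent; stacking and
juxtaposing preserve this. -/
theorem edgesValue_mul_eval [CharZero K] {l m : List ℕ} (X : Net l m) :
    edgesValue K l * X.eval K = X.eval K := by
  induction X with
  | edges l => exact edgesValue_mul_self l
  | cup a => rw [edgesValue_nil, Matrix.one_mul]
  | cap a => rw [Net.eval, ← Matrix.mul_assoc, edgesValue_mul_self]
  | cross a b => simp only [Net.eval, ← Matrix.mul_assoc, edgesValue_mul_self]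
  | merge a b c h => simp only [Net.eval, ← Matrix.mul_assoc, edgesValue_mul_self]
  | split a b c h => simp only [Net.eval, ← Matrix.mul_assoc, edgesValue_mul_self]
  | stack lower upper ih _ => rw [Net.eval, ← Matrix.mul_assoc, ih]
  | beside left right ih ih' => rw [eval_beside, edgesValue_append, juxtapose_mul, ih, ih']

theorem eval_mul_edgesValue [CharZero K] {l m : List ℕ} (X : Net l m) :
    X.eval K * edgesValue K m = X.eval K := by
  induction X with
  | edges l => exact edgesValue_mul_self l
  | cup a => rw [Net.eval, Matrix.mul_assoc, edgesValue_mul_self]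
  | cap a => rw [edgesValue_nil, Matrix.mul_one]
  | cross a b => simp only [Net.eval, Matrix.mul_assoc, edgesValue_mul_self]
  | merge a b c h => simp only [Net.eval, Matrix.mul_assoc, edgesValue_mul_self]
  | split a b c h => simp only [Net.eval, Matrix.mul_assoc, edgesValue_mul_self]
  | stack lower upper _ ih => rw [Net.eval, Matrix.mul_assoc, ih]
  | beside left right ih ih' => rw [eval_beside, edgesValue_append, juxtapose_mul, ih, ih']

/-! ### Invariance under `SL₂` -/

/-- A tensor that commutes with the action of the special linear group on the strands. -/
def IsInvariant {l m : List ℕ} (T : Matrix (State l) (State m) K) : Prop :=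
  ∀ g : Matrix (Fin 2) (Fin 2) K, g.det = 1 → rowPower g l * T = T * rowPower g m

theorem IsInvariant.mul {l m n : List ℕ} {S : Matrix (State l) (State m) K}
    {T : Matrix (State m) (State n) K} (hS : IsInvariant S) (hT : IsInvariant T) :
    IsInvariant (S * T) := fun g hg => by
  rw [← Matrix.mul_assoc, hS g hg, Matrix.mul_assoc, hT g hg, Matrix.mul_assoc]

theorem IsInvariant.juxtapose {l m l' m' : List ℕ} {S : Matrix (State l) (State m) K}
    {T : Matrix (State l') (State m') K} (hS : IsInvariant S) (hT : IsInvariant T) :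
    IsInvariant (juxtapose S T) := fun g hg => by
  rw [rowPower_append, rowPower_append, juxtapose_mul, juxtapose_mul, hS g hg, hT g hg]

theorem IsInvariant.smul {l m : List ℕ} {T : Matrix (State l) (State m) K}
    (hT : IsInvariant T) (k : K) : IsInvariant (k • T) := fun g hg => by
  rw [Matrix.mul_smul, Matrix.smul_mul, hT g hg]

theorem IsInvariant.sub {l m : List ℕ} {S T : Matrix (State l) (State m) K}
    (hS : IsInvariant S) (hT : IsInvariant T) : IsInvariant (S - T) := fun g hg => by
  rw [Matrix.mul_sub, Matrix.sub_mul, hS g hg, hT g hg]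

theorem IsInvariant.transpose {l m : List ℕ} {T : Matrix (State l) (State m) K}
    (hT : IsInvariant T) : IsInvariant Tᵀ := fun g hg => by
  have h := congrArg Matrix.transpose (hT gᵀ (by rw [Matrix.det_transpose, hg]))
  simpa only [Matrix.transpose_mul, rowPower_transpose, Matrix.transpose_transpose] using h.symm

theorem isInvariant_edgesValue (l : List ℕ) : IsInvariant (edgesValue K l) :=
  fun g _ => rowPower_mul_edgesValue g l

/-- In dimension two, preserving the symplectic form amounts to having determinant one. -/
theorem mul_omega_mul_transpose {g : Matrix (Fin 2) (Fin 2) K} (hg : g.det = 1) :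
    g * omega K * gᵀ = omega K := by
  rw [Matrix.det_fin_two] at hg
  ext i j
  fin_cases i <;> fin_cases j <;> simp [omega, Matrix.mul_apply, Fin.sum_univ_two]
  · ring
  · linear_combination hg
  · linear_combination -hg
  · ring

theorem State.sum_cons {a : ℕ} {l : List ℕ} (f : State (a :: l) → K) :
    ∑ s, f s = ∑ u : Fin a → Fin 2, ∑ v : State l, f (u, v) :=
  Fintype.sum_prod_type (α₁ := Fin a → Fin 2) (α₂ := State l) f

/-- The state of a single edge. -/
def State.single {a : ℕ} (u : Fin a → Fin 2) : State [a] := (u, ())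

/-- The state of a pair of edges. -/
def State.pair {a b : ℕ} (u : Fin a → Fin 2) (v : Fin b → Fin 2) : State [a, b] := (u, v, ())

theorem State.sum_single {a : ℕ} (f : State [a] → K) :
    ∑ s, f s = ∑ u : Fin a → Fin 2, f (State.single u) := by
  rw [State.sum_cons]
  exact Finset.sum_congr rfl fun u _ => Fintype.sum_unique _

theorem State.sum_pair {a b : ℕ} (f : State [a, b] → K) :
    ∑ s, f s = ∑ u : Fin a → Fin 2, ∑ v : Fin b → Fin 2, f (State.pair u v) := by
  rw [State.sum_cons]
  exact Finset.sum_congr rfl fun u _ => State.sum_single fun v => f (u, v)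

theorem strandPower_append (g : Matrix (Fin 2) (Fin 2) K) {m n : ℕ} (s : Fin (m + n) → Fin 2)
    (u : Fin m → Fin 2) (v : Fin n → Fin 2) :
    strandPower g (m + n) s (Fin.append u v) =
      strandPower g m (fun i => s (Fin.castAdd n i)) u *
        strandPower g n (fun i => s (Fin.natAdd m i)) v := by
  simp only [strandPower, Fin.prod_univ_add, Fin.append_left, Fin.append_right]

theorem sum_append {m n : ℕ} (f : (Fin (m + n) → Fin 2) → K) :
    ∑ s, f s = ∑ u : Fin m → Fin 2, ∑ v : Fin n → Fin 2, f (Fin.append u v) := by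
  rw [← (Fin.appendEquiv m n).sum_comp, Fintype.sum_prod_type]
  rfl

/-- Nested half-circles absorb the action of `g` on both ends. -/
theorem sum_strandPower_mul_halfCircles {g : Matrix (Fin 2) (Fin 2) K} (hg : g.det = 1) {n : ℕ}
    (s t : Fin n → Fin 2) :
    ∑ u : Fin n → Fin 2, ∑ v : Fin n → Fin 2,
      strandPower g n s u * strandPower g n t v * ∏ x, omega K (u x) (v x.rev) =
      ∏ x, omega K (s x) (t x.rev) := by
  -- Reversing the order of the right ends turns the nested half-circles into a tensor power of `ω`,
  -- for which the claim is `g * ω * gᵀ = ω`.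
  have h := congrFun (congrFun (strandPower_mul (g * omega K) gᵀ n) s) (t ∘ Fin.revPerm)
  rw [mul_omega_mul_transpose hg, ← strandPower_mul] at h
  change _ = ∏ x, omega K (s x) (t x.rev) at h
  rw [← h, Finset.sum_comm, Matrix.mul_apply,
    ← (Equiv.arrowCongr Fin.revPerm (Equiv.refl (Fin 2))).sum_comp]
  refine Finset.sum_congr rfl fun v _ => ?_
  rw [Matrix.mul_apply, Finset.sum_mul]
  refine Finset.sum_congr rfl fun u _ => ?_
  have h1 : strandPower gᵀ n v (t ∘ Fin.revPerm) =
      strandPower g n t (v ∘ Fin.revPerm) := by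
    rw [← strandPower_comp g Fin.revPerm, ← strandPower_transpose, Matrix.transpose_apply]
    congr 1
    ext x; simp
  rw [h1]
  have h2 : (Equiv.arrowCongr Fin.revPerm (Equiv.refl (Fin 2))) v = v ∘ Fin.revPerm := by
    ext x; simp
  rw [h2]
  simp only [strandPower, Function.comp_apply, Fin.revPerm_apply, Fin.rev_rev]
  ring

/-- Through strands carry `g` from bottom to top, and half-circles absorb it. The strand numbers
`p`, `q`, `r` are free variables, so that `subst` removes the casts from the labels. -/
theorem sum_strandPower_mul_vertex {g : Matrix (Fin 2) (Fin 2) K} (hg : g.det = 1)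
    {p q r a b c : ℕ} (h₁ : q + p = a) (h₂ : p + r = b) (h₃ : q + r = c)
    (s : Fin a → Fin 2) (t : Fin b → Fin 2) (w : Fin c → Fin 2)
    (F : (Fin a → Fin 2) → (Fin b → Fin 2) → (Fin c → Fin 2) → K)
    (hF : ∀ u v w, F u v w =
      (∏ x : Fin q,
        delta K (u (Fin.cast h₁ (Fin.castAdd _ x))) (w (Fin.cast h₃ (Fin.castAdd _ x)))) *
      (∏ y : Fin r,
        delta K (v (Fin.cast h₂ (Fin.natAdd _ y))) (w (Fin.cast h₃ (Fin.natAdd _ y)))) *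
      ∏ z : Fin p,
        omega K (u (Fin.cast h₁ (Fin.natAdd _ z))) (v (Fin.cast h₂ (Fin.castAdd _ z.rev)))) :
    ∑ u, ∑ v, strandPower g a s u * strandPower g b t v * F u v w =
      ∑ w', F s t w' * strandPower g c w' w := by
  subst h₁ h₂ h₃
  simp only [Fin.cast_eq_self] at hF
  have hδ : ∀ {n : ℕ} (u v : Fin n → Fin 2),
      ∏ x, delta K (u x) (v x) = if u = v then 1 else 0 := fun u v =>
    congrFun (congrFun (strandPower_one _) u) v
  obtain ⟨w₁, w₂, rfl⟩ : ∃ w₁ w₂, w = Fin.append w₁ w₂ :=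
    ⟨_, _, Fin.append_castAdd_natAdd.symm⟩
  simp only [hF]
  rw [sum_append, sum_append]
  simp only [sum_append (m := p), strandPower_append, Fin.append_left, Fin.append_right, hδ]
  rw [Fintype.sum_eq_single w₁ fun u hu => by simp [hu],
    Fintype.sum_eq_single (fun i => s (Fin.castAdd p i)) fun u hu => by simp [hu.symm],
    Fintype.sum_eq_single (fun i => t (Fin.natAdd p i)) fun u hu => by simp [hu.symm]]
  have hv : ∀ u v : Fin p → Fin 2, ∑ v' : Fin r → Fin 2,
      strandPower g q (fun i => s (Fin.castAdd p i)) w₁ *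
        strandPower g p (fun i => s (Fin.natAdd q i)) u *
        (strandPower g p (fun i => t (Fin.castAdd r i)) v *
          strandPower g r (fun i => t (Fin.natAdd p i)) v') *
        ((if w₁ = w₁ then 1 else 0) * (if v' = w₂ then 1 else 0) *
          ∏ z, omega K (u z) (v z.rev)) =
      strandPower g q (fun i => s (Fin.castAdd p i)) w₁ *
        strandPower g r (fun i => t (Fin.natAdd p i)) w₂ *
        (strandPower g p (fun i => s (Fin.natAdd q i)) u *
          strandPower g p (fun i => t (Fin.castAdd r i)) v * ∏ z, omega K (u z) (v z.rev)) := by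
    intro u v
    rw [Fintype.sum_eq_single w₂ fun u hu => by simp [hu]]
    simp only [if_true]
    ring
  refine (Finset.sum_congr rfl fun u _ => Finset.sum_congr rfl fun v _ => hv u v).trans ?_
  simp only [← Finset.mul_sum, sum_strandPower_mul_halfCircles hg, if_true]
  ring

theorem isInvariant_mergeStrands {a b c : ℕ} (h : Admissible a b c) :
    IsInvariant (mergeStrands K h) := fun g hg => by
  ext s w
  rw [Matrix.mul_apply, Matrix.mul_apply, State.sum_pair, State.sum_single]
  have key := sum_strandPower_mul_vertex hg h.eq₁ h.eq₂ h.eq₃ s.1 s.2.1 w.1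
    (vertexStrands K (omega K) h) fun _ _ _ => rfl
  refine Eq.trans (Finset.sum_congr rfl fun u _ => Finset.sum_congr rfl fun v _ => ?_)
    (key.trans (Finset.sum_congr rfl fun u _ => ?_))
  -- The factor `1` is the value of `rowPower` on the empty row that ends the list.
  · exact congrArg (· * _) (congrArg (HMul.hMul _) (mul_one _))
  · exact congrArg (HMul.hMul _) (mul_one _).symm

theorem Omega_eq_neg_omega (i j : Fin 2) : Omega K i j = -omega K i j := by
  fin_cases i <;> fin_cases j <;> simp [omega, Omega]

theorem splitStrands_eq {a b c : ℕ} (h : Admissible a b c) :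
    splitStrands K h = (-1 : K) ^ strands a b c • (mergeStrands K h)ᵀ := by
  ext s t
  simp only [splitStrands, mergeStrands, vertexStrands, Matrix.smul_apply, smul_eq_mul,
    Matrix.transpose_apply, Omega_eq_neg_omega, Finset.prod_neg, Finset.card_univ,
    Fintype.card_fin]
  ring

/-- Each half-circle contributes a sign, as `Ω = -ω`. This reduces splits to merges and later makes
`θ` a signed sum of squares. -/
theorem eval_split_eq {a b c : ℕ} (h : Admissible a b c) :
    (Net.split a b c h).eval K = (-1 : K) ^ strands a b c • ((Net.merge a b c h).eval K)ᵀ := by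
  simp only [Net.eval, splitStrands_eq, Matrix.transpose_mul, edgesValue_transpose,
    Matrix.mul_smul, Matrix.smul_mul, Matrix.mul_assoc]

theorem isInvariant_merge {a b c : ℕ} (h : Admissible a b c) :
    IsInvariant ((Net.merge a b c h).eval K) :=
  ((isInvariant_edgesValue _).mul (isInvariant_mergeStrands h)).mul (isInvariant_edgesValue _)

theorem isInvariant_split {a b c : ℕ} (h : Admissible a b c) :
    IsInvariant ((Net.split a b c h).eval K) := by
  rw [eval_split_eq]
  exact (isInvariant_merge (K := K) h).transpose.smul _

theorem isInvariant_triangleNet {a b c A B C : ℕ} (ha : Admissible a B C) (hb : Admissible A b C)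
    (hc : Admissible A B c) : IsInvariant ((triangleNet a b c A B C ha hb hc).eval K) :=
  IsInvariant.mul (IsInvariant.juxtapose (isInvariant_split _) (isInvariant_edgesValue [b]))
    (IsInvariant.mul (IsInvariant.juxtapose (isInvariant_edgesValue [B]) (isInvariant_merge _))
      (isInvariant_merge _))

end

/-! ### Uniqueness of the invariant tensor -/

/-- The number of strands that carry the second basis vector. -/
def numOnes {n : ℕ} (s : Fin n → Fin 2) : ℕ := ∑ x, (s x : ℕ)

theorem numOnes_eq_card {n : ℕ} (s : Fin n → Fin 2) :
    numOnes s = Fintype.card {x // s x = 1} := by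
  rw [Fintype.card_subtype, Finset.card_filter]
  refine Finset.sum_congr rfl fun x _ => ?_
  generalize s x = i
  fin_cases i <;> rfl

/-- The number of ones classifies the orbits of states under permutation, so a symmetric tensor
depends only on it. -/
theorem exists_perm_of_numOnes_eq {n : ℕ} {s t : Fin n → Fin 2} (h : numOnes s = numOnes t) :
    ∃ σ : Equiv.Perm (Fin n), s = t ∘ σ := by
  have h1 : Fintype.card {x // s x = 1} = Fintype.card {x // t x = 1} := by
    rw [← numOnes_eq_card, ← numOnes_eq_card, h]
  have h0 : ∀ s : Fin n → Fin 2,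
      Fintype.card {x // s x = 0} = n - Fintype.card {x // s x = 1} := fun s => by
    have h := Fintype.card_subtype_compl fun x => s x = 1
    rw [Fintype.card_fin] at h
    rw [← h]
    refine Fintype.card_congr (Equiv.subtypeEquivRight fun x => ?_)
    generalize s x = i
    fin_cases i <;> simp
  have e : ∀ i, Nonempty ({x // s x = i} ≃ {x // t x = i}) := fun i => by
    refine Fintype.card_eq.1 ?_
    fin_cases i
    · exact (h0 s).trans ((congrArg _ h1).trans (h0 t).symm)
    · exact h1
  refine ⟨Equiv.ofFiberEquiv fun i => (e i).some, ?_⟩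
  funext x
  exact (Equiv.ofFiberEquiv_map _ x).symm

section

variable {K : Type*} [Field K]

open Polynomial in
/-- A symmetric tensor is determined by its values on the powers of the vectors `(1, α)`. -/
theorem eq_zero_of_sum_pow_numOnes_eq_zero [CharZero K] {n : ℕ} {f : (Fin n → Fin 2) → K}
    (hf : ∀ (σ : Equiv.Perm (Fin n)) s, f (s ∘ σ) = f s) {S : Set K} (hS : S.Infinite)
    (h : ∀ α ∈ S, ∑ s, α ^ numOnes s * f s = 0) (s : Fin n → Fin 2) : f s = 0 := by
  have hp : ∑ s, C (f s) * X ^ numOnes s = 0 := by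
    refine eq_zero_of_infinite_isRoot _ (hS.mono fun α hα => ?_)
    have := h α hα
    simpa only [Set.mem_ofPred_eq, IsRoot, eval_finsetSum, eval_mul, eval_C, eval_pow, eval_X,
      mul_comm] using this
  have hc := congrArg (fun p => coeff p (numOnes s)) hp
  simp only [finsetSum_coeff, coeff_C_mul_X_pow, coeff_zero] at hc
  -- By symmetry the coefficient of `X ^ numOnes s` is `f s` times the size of the orbit of `s`,
  -- which is nonzero in characteristic zero.
  have hs : ∀ t, (if numOnes s = numOnes t then f t else 0) =
      (if numOnes s = numOnes t then 1 else 0) * f s := fun t => by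
    split_ifs with hst
    · obtain ⟨σ, rfl⟩ := exists_perm_of_numOnes_eq hst
      rw [hf, one_mul]
    · rw [zero_mul]
  rw [Finset.sum_congr rfl fun t _ => hs t, ← Finset.sum_mul, Finset.sum_boole] at hc
  refine (mul_eq_zero.1 hc).resolve_left
    (Nat.cast_ne_zero.2 (Finset.card_ne_zero_of_mem (a := s) ?_))
  simp

theorem strandPower_diagonal (d : Fin 2 → K) (n : ℕ) :
    strandPower (Matrix.diagonal d) n = Matrix.diagonal fun s => ∏ x, d (s x) := by
  ext s t
  by_cases h : s = t
  · subst h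
    simp [strandPower]
  · obtain ⟨x, hx⟩ := Function.ne_iff.1 h
    rw [Matrix.diagonal_apply_ne _ h]
    exact Finset.prod_eq_zero (Finset.mem_univ x) (Matrix.diagonal_apply_ne _ hx)

theorem prod_zpow_numOnes [CharZero K] {n : ℕ} (s : Fin n → Fin 2) :
    ∏ x, (2 : K) ^ (1 - 2 * ((s x : ℕ) : ℤ)) = 2 ^ ((n : ℤ) - 2 * numOnes s) := by
  have h : ∀ (t : Finset (Fin n)) (f : Fin n → ℤ),
      ∏ x ∈ t, (2 : K) ^ f x = 2 ^ ∑ x ∈ t, f x := fun t f => by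
    induction t using Finset.cons_induction with
    | empty => simp
    | cons a t ha ih => rw [Finset.prod_cons, Finset.sum_cons, zpow_add₀ two_ne_zero, ih]
  rw [h, Finset.sum_sub_distrib, ← Finset.mul_sum, numOnes]
  simp

/-- An invariant symmetric tensor is determined by a single component. -/
theorem eq_zero_of_invariant [CharZero K] {a b c : ℕ}
    {F : (Fin a → Fin 2) → (Fin b → Fin 2) → (Fin c → Fin 2) → K}
    (ha : ∀ (σ : Equiv.Perm (Fin a)) u v w, F (u ∘ σ) v w = F u v w)
    (hb : ∀ (σ : Equiv.Perm (Fin b)) u v w, F u (v ∘ σ) w = F u v w)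
    (hc : ∀ (σ : Equiv.Perm (Fin c)) u v w, F u v (w ∘ σ) = F u v w)
    (hF : ∀ g : Matrix (Fin 2) (Fin 2) K, g.det = 1 → ∀ s t w,
      ∑ u, ∑ v, strandPower g a s u * strandPower g b t v * F u v w =
        ∑ w', F s t w' * strandPower g c w' w)
    {w₀ : Fin c → Fin 2} (hw₀ : a + 2 * numOnes w₀ = b + c)
    (h₀ : F (fun _ => 0) (fun _ => 1) w₀ = 0) (u : Fin a → Fin 2) (v : Fin b → Fin 2)
    (w : Fin c → Fin 2) : F u v w = 0 := by
  have hrow : ∀ w, F (fun _ => 0) (fun _ => 1) w = 0 := by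
    intro w
    by_cases hw : numOnes w = numOnes w₀
    · obtain ⟨σ, rfl⟩ := exists_perm_of_numOnes_eq hw
      rw [hc, h₀]
    · by_contra hne
      -- The torus element `diag(2, 1/2)`: since `2` has infinite order it separates all weights,
      -- and a nonzero component forces `a - b = c - 2 * numOnes w`.
      let d : Fin 2 → K := fun i => 2 ^ (1 - 2 * ((i : ℕ) : ℤ))
      have hd : (Matrix.diagonal d).det = 1 := by
        rw [Matrix.det_diagonal, Fin.prod_univ_two, ← zpow_add₀ two_ne_zero]
        simp
      have key := hF _ hd (fun _ => 0) (fun _ => 1) w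
      simp only [strandPower_diagonal] at key
      rw [Fintype.sum_eq_single (fun _ => 0) fun u hu => by
          simp [Matrix.diagonal_apply_ne _ hu.symm],
        Fintype.sum_eq_single (fun _ => 1) fun u hu => by
          simp [Matrix.diagonal_apply_ne _ hu.symm],
        Fintype.sum_eq_single w fun u hu => by
          simp [Matrix.diagonal_apply_ne _ hu]] at key
      simp only [Matrix.diagonal_apply_eq, d, prod_zpow_numOnes] at key
      rw [mul_comm, ← zpow_add₀ two_ne_zero] at key
      have key' := mul_left_cancel₀ hne key
      have hinj : Function.Injective fun z : ℤ => (2 : K) ^ z := fun x y hxy => by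
        refine zpow_right_injective₀ (a := (2 : ℚ)) (by norm_num) (by norm_num)
          (Rat.cast_injective (α := K) ?_)
        push_cast
        exact hxy
      have := hinj key'
      simp only [numOnes, Fin.coe_ofNat_eq_mod, Finset.sum_const, Finset.card_univ,
        Fintype.card_fin, smul_eq_mul] at this
      unfold numOnes at hw hw₀
      omega
  have hsum : ∀ α β : K, α ≠ β → ∀ w,
      ∑ u, α ^ numOnes u * ∑ v, β ^ numOnes v * F u v w = 0 := by
    intro α β hαβ w
    have hne : β - α ≠ 0 := sub_ne_zero.2 hαβ.symm
    -- The rows are `(1, α)` and a multiple of `(1, β)` scaled to make the determinant one. By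
    -- `hrow` the other side of the invariance vanishes.
    have key := hF !![1, α; (β - α)⁻¹, (β - α)⁻¹ * β] (by
      rw [Matrix.det_fin_two_of]
      field_simp) (fun _ => 0) (fun _ => 1) w
    simp only [hrow, zero_mul, Finset.sum_const_zero] at key
    have h0 : ∀ u : Fin a → Fin 2,
        strandPower !![1, α; (β - α)⁻¹, (β - α)⁻¹ * β] a (fun _ => 0) u = α ^ numOnes u := by
      intro u
      rw [numOnes, ← Finset.prod_pow_eq_pow_sum]
      refine Finset.prod_congr rfl fun x _ => ?_
      generalize u x = i
      fin_cases i <;> simp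
    have h1 : ∀ v : Fin b → Fin 2,
        strandPower !![1, α; (β - α)⁻¹, (β - α)⁻¹ * β] b (fun _ => 1) v =
          (β - α)⁻¹ ^ b * β ^ numOnes v := by
      intro v
      have hb : (β - α)⁻¹ ^ b = ∏ _x : Fin b, (β - α)⁻¹ := by simp
      rw [numOnes, ← Finset.prod_pow_eq_pow_sum, hb, ← Finset.prod_mul_distrib]
      refine Finset.prod_congr rfl fun x _ => ?_
      generalize v x = i
      fin_cases i <;> simp
    simp only [h0, h1] at key
    refine (mul_eq_zero.1 (?_ : (β - α)⁻¹ ^ b * _ = 0)).resolve_left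
      (pow_ne_zero _ (inv_ne_zero hne))
    rw [← key, Finset.mul_sum]
    refine Finset.sum_congr rfl fun u _ => ?_
    rw [Finset.mul_sum, Finset.mul_sum]
    refine Finset.sum_congr rfl fun v _ => ?_
    ring
  -- First `β` is arbitrary and `v` is eliminated; then, with `β` fixed, `α` runs over the infinite
  -- complement of `{β}`.
  refine eq_zero_of_sum_pow_numOnes_eq_zero (f := fun v => F u v w) (fun σ v => hb σ u v w)
    Set.infinite_univ
    (fun β _ => ?_) v
  refine eq_zero_of_sum_pow_numOnes_eq_zero (f := fun u => ∑ v, β ^ numOnes v * F u v w)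
    (fun σ u => ?_) (Set.finite_singleton β).infinite_compl (fun α hα => hsum α β hα w) u
  simp only [ha]

theorem symmetrizer_comp_left {n : ℕ} (s t : Fin n → Fin 2) (σ : Equiv.Perm (Fin n)) :
    symmetrizer K n (s ∘ σ) t = symmetrizer K n s t := by
  rw [← symmetrizer_transpose, Matrix.transpose_apply, Matrix.transpose_apply,
    symmetrizer_comp_right]

/-- An invariant tensor with symmetrized ends is determined by a single component. -/
theorem eq_zero_of_isInvariant [CharZero K] {a b c : ℕ} {D : Matrix (State [a, b]) (State [c]) K}
    (hD : IsInvariant D) (hl : edgesValue K [a, b] * D = D) (hr : D * edgesValue K [c] = D)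
    {w₀ : Fin c → Fin 2} (hw₀ : a + 2 * numOnes w₀ = b + c)
    (h₀ : D (State.pair (fun _ => 0) fun _ => 1) (State.single w₀) = 0) : D = 0 := by
  ext ⟨u, v, i⟩ ⟨w, j⟩
  refine eq_zero_of_invariant (F := fun u v w => D (State.pair u v) (State.single w))
    (fun σ u v w => ?_) (fun σ u v w => ?_) (fun σ u v w => ?_) (fun g hg s t w => ?_) hw₀ h₀ u v w
  · rw [← hl]
    refine Finset.sum_congr rfl fun s _ => congrArg (· * _) ?_
    exact congrArg (· * _) (symmetrizer_comp_left u s.1 σ)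
  · rw [← hl]
    refine Finset.sum_congr rfl fun s _ => congrArg (· * _) (congrArg (HMul.hMul _) ?_)
    exact congrArg (· * _) (symmetrizer_comp_left v s.2.1 σ)
  · rw [← hr]
    refine Finset.sum_congr rfl fun s _ => congrArg (HMul.hMul _) ?_
    exact congrArg (· * _) (symmetrizer_comp_right s.1 w σ)
  · have key := congrFun (congrFun (hD g hg) (State.pair s t)) (State.single w)
    have h1 := (State.sum_pair fun x =>
      rowPower g [a, b] (State.pair s t) x * D x (State.single w)).symm.trans
        (key.trans (State.sum_single fun x =>
          D (State.pair s t) x * rowPower g [c] x (State.single w)))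
    refine Eq.trans (Finset.sum_congr rfl fun u _ => Finset.sum_congr rfl fun v _ => ?_)
      (h1.trans (Finset.sum_congr rfl fun u _ => ?_))
    · exact congrArg (· * _) (congrArg (HMul.hMul _) (mul_one _).symm)
    · exact congrArg (HMul.hMul _) (mul_one _)

theorem symmetrizer_const [CharZero K] {n : ℕ} (i : Fin 2) (t : Fin n → Fin 2) :
    symmetrizer K n (fun _ => i) t = if t = fun _ => i then 1 else 0 := by
  have h : ∀ σ : Equiv.Perm (Fin n), (fun _ => i) ∘ σ = fun _ => i := fun _ => rfl
  simp only [symmetrizer, h, Finset.sum_const, Finset.card_univ, Fintype.card_perm,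
    Fintype.card_fin, nsmul_eq_mul]
  rw [inv_mul_cancel_left₀ (Nat.cast_ne_zero.2 n.factorial_ne_zero)]

theorem symmetrizer_self_ne_zero [CharZero K] {n : ℕ} (s : Fin n → Fin 2) :
    symmetrizer K n s s ≠ 0 := by
  rw [symmetrizer, Finset.sum_boole]
  refine mul_ne_zero (inv_ne_zero (Nat.cast_ne_zero.2 n.factorial_ne_zero))
    (Nat.cast_ne_zero.2 (Finset.card_ne_zero_of_mem (a := 1) ?_))
  simp

/-- The state whose first `q` strands carry the first basis vector. -/
def stepState (q c : ℕ) : Fin c → Fin 2 := fun i => if (i : ℕ) < q then 0 else 1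

theorem numOnes_stepState {q r c : ℕ} (h : q + r = c) : numOnes (stepState q c) = r := by
  subst h
  simp [numOnes, stepState, Fin.sum_univ_add]

/-- Every half-circle joins `e 0` to `e 1` and contributes `1`, while the through strands force the
output. -/
theorem vertexStrands_const {a b c : ℕ} (h : Admissible a b c) (w : Fin c → Fin 2) :
    vertexStrands K (omega K) h (fun _ => 0) (fun _ => 1) w =
      if w = stepState (strands a c b) c then 1 else 0 := by
  have hω : ∏ _z : Fin (strands a b c), omega K 0 1 = 1 := by simp [omega]
  rw [vertexStrands, hω, mul_one]
  split_ifs with hw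
  · subst hw
    have h0 : ∀ x : Fin (strands a c b), stepState (strands a c b) c
        (Fin.cast h.eq₃ (Fin.castAdd (strands b c a) x)) = 0 := fun x => by simp [stepState]
    have h1 : ∀ x : Fin (strands b c a), stepState (strands a c b) c
        (Fin.cast h.eq₃ (Fin.natAdd (strands a c b) x)) = 1 := fun x => by simp [stepState]
    have h2 : ∀ i, delta K i i = 1 := Matrix.one_apply_eq
    simp only [h0, h1, h2, Finset.prod_const_one, mul_one]
  · obtain ⟨i, hi⟩ := Function.ne_iff.1 hw
    by_cases hq : (i : ℕ) < strands a c b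
    · have h0 : Fin.cast h.eq₃ (Fin.castAdd _ ⟨i, hq⟩) = i := rfl
      rw [stepState, if_pos hq] at hi
      rw [Finset.prod_eq_zero (Finset.mem_univ ⟨i, hq⟩), zero_mul]
      rw [h0]
      exact Matrix.one_apply_ne hi.symm
    · have hlt : (i : ℕ) - strands a c b < strands b c a := by
        have := h.eq₃
        omega
      have h0 : Fin.cast h.eq₃ (Fin.natAdd _ ⟨i - strands a c b, hlt⟩) = i := by
        ext
        simp only [Fin.val_cast, Fin.val_natAdd]
        omega
      rw [stepState, if_neg hq] at hi
      refine mul_eq_zero_of_right _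
        (Finset.prod_eq_zero (Finset.mem_univ ⟨i - strands a c b, hlt⟩) ?_)
      rw [h0]
      exact Matrix.one_apply_ne hi.symm

theorem eval_merge_apply_stepState_ne_zero [CharZero K] {a b c : ℕ} (h : Admissible a b c) :
    (Net.merge a b c h).eval K (State.pair (fun _ => 0) fun _ => 1)
      (State.single (stepState (strands a c b) c)) ≠
      0 := by
  have h1 : ∀ w : Fin c → Fin 2,
      (edgesValue K [a, b] * mergeStrands K h) (State.pair (fun _ => 0) fun _ => 1)
        (State.single w) = if w = stepState (strands a c b) c then 1 else 0 := by
    intro w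
    refine (State.sum_pair fun x =>
      edgesValue K [a, b] (State.pair (fun _ => 0) fun _ => 1) x *
        mergeStrands K h x (State.single w)).trans ?_
    have h0 : ∀ (u : Fin a → Fin 2) (v : Fin b → Fin 2),
        edgesValue K [a, b] (State.pair (fun _ => 0) fun _ => 1) (State.pair u v) =
          (if u = fun _ => 0 then 1 else 0) * if v = fun _ => 1 then 1 else 0 := fun u v => by
      rw [← symmetrizer_const, ← symmetrizer_const]
      exact congrArg (HMul.hMul _) (mul_one _)
    simp only [h0]
    rw [Fintype.sum_eq_single (fun _ => 0) fun u hu => by simp [hu],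
      Fintype.sum_eq_single (fun _ => 1) fun u hu => by simp [hu]]
    simp only [if_true, one_mul]
    exact vertexStrands_const h w
  have h2 : (Net.merge a b c h).eval K (State.pair (fun _ => 0) fun _ => 1)
      (State.single (stepState (strands a c b) c)) =
      symmetrizer K c (stepState (strands a c b) c) (stepState (strands a c b) c) := by
    refine (State.sum_single fun x =>
      (edgesValue K [a, b] * mergeStrands K h) (State.pair (fun _ => 0) fun _ => 1) x *
        edgesValue K [c] x (State.single (stepState (strands a c b) c))).trans ?_
    simp only [h1]
    rw [Fintype.sum_eq_single (stepState (strands a c b) c) fun u hu => by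
      rw [if_neg hu, zero_mul], if_pos rfl, one_mul]
    exact mul_one _
  rw [h2]
  exact symmetrizer_self_ne_zero _

/-- Every invariant tensor with symmetrized ends is a multiple of the trivalent vertex. -/
theorem IsInvariant.exists_eq_smul_merge [CharZero K] {a b c : ℕ} (h : Admissible a b c)
    {T : Matrix (State [a, b]) (State [c]) K} (hT : IsInvariant T)
    (hl : edgesValue K [a, b] * T = T) (hr : T * edgesValue K [c] = T) :
    ∃ k : K, T = k • (Net.merge a b c h).eval K := by
  have hne := eval_merge_apply_stepState_ne_zero (K := K) h
  set M := (Net.merge a b c h).eval K with hM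
  set w₀ := stepState (strands a c b) c
  -- With `p` half-circles and `q`, `r` through strands, both sides are `p + q + 2 * r`.
  have hw₀ : a + 2 * numOnes w₀ = b + c := by
    rw [numOnes_stepState h.eq₃]
    have := h.eq₁
    have := h.eq₂
    have := h.eq₃
    omega
  refine ⟨T (State.pair (fun _ => 0) fun _ => 1) (State.single w₀) /
      M (State.pair (fun _ => 0) fun _ => 1) (State.single w₀),
    sub_eq_zero.1 (eq_zero_of_isInvariant (hT.sub ((isInvariant_merge h).smul _)) ?_ ?_ hw₀ ?_)⟩
  · rw [Matrix.mul_sub, Matrix.mul_smul, hl, edgesValue_mul_eval]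
  · rw [Matrix.sub_mul, Matrix.smul_mul, hr, eval_mul_edgesValue]
  · rw [Matrix.sub_apply, Matrix.smul_apply, smul_eq_mul, div_mul_cancel₀ _ hne, sub_self]

/-! ### Closing edges and the theta network -/

theorem omega_mul_transpose : omega K * (omega K)ᵀ = 1 := by
  ext i j
  fin_cases i <;> fin_cases j <;> simp [omega, Matrix.mul_apply, Fin.sum_univ_two]

theorem sum_comp_rev {n : ℕ} (f : (Fin n → Fin 2) → K) :
    ∑ s, f (s ∘ Fin.revPerm) = ∑ s, f s :=
  (Equiv.arrowCongr Fin.revPerm (Equiv.refl (Fin 2))).sum_comp f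

/-- Closing the two ends of an edge around the right side of the page is a trace, up to a sign. -/
theorem cupStrands_mul_mul_capStrands {c : ℕ} {N : Matrix (State [c]) (State [c]) K}
    (hN : N * edgesValue K [c] = N) {J : Matrix (State [c, c]) (State [c, c]) K}
    (hJ : J = juxtapose N (edgesValue K [c])) (i j : State []) :
    (cupStrands K c * J * capStrands K c) i j = (-1) ^ c * N.trace := by
  have hcup : ∀ u v : Fin c → Fin 2, cupStrands K c i (State.pair u (v ∘ Fin.revPerm)) =
      (-1) ^ c * strandPower (omega K) c u v := fun u v => by
    simp only [cupStrands, Omega_eq_neg_omega, Finset.prod_neg, Finset.card_univ,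
      Fintype.card_fin]
    refine congrArg (HMul.hMul _) (Finset.prod_congr rfl fun x _ => ?_)
    exact congrArg (fun y => omega K (u x) (v y)) (Fin.rev_rev x)
  have hcap : ∀ u v : Fin c → Fin 2, capStrands K c (State.pair u (v ∘ Fin.revPerm)) j =
      strandPower (omega K) c u v := fun u v =>
    Finset.prod_congr rfl fun x _ => congrArg (fun y => omega K (u x) (v y)) (Fin.rev_rev x)
  have hmid : ∀ u v w x : Fin c → Fin 2,
      J (State.pair u (v ∘ Fin.revPerm)) (State.pair w (x ∘ Fin.revPerm)) =
      N (State.single u) (State.single w) * symmetrizer K c v x := fun u v w x => by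
    have h : symmetrizer K c (v ∘ Fin.revPerm) (x ∘ Fin.revPerm) = symmetrizer K c v x := by
      rw [symmetrizer_comp_left, symmetrizer_comp_right]
    rw [hJ, ← h]
    exact congrArg (N (State.single u) (State.single w) * ·) (mul_one _)
  -- Sliding the symmetrizer of the returning edge past the half-circles leaves it unchanged,
  -- because `ω * ωᵀ = 1`.
  have hW : strandPower (omega K) c * symmetrizer K c * (strandPower (omega K) c)ᵀ =
      symmetrizer K c := by
    rw [strandPower_mul_symmetrizer, strandPower_transpose, Matrix.mul_assoc, strandPower_mul,
      omega_mul_transpose, strandPower_one, Matrix.mul_one]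
  have htr : N.trace =
      ∑ u, ∑ w, N (State.single u) (State.single w) * symmetrizer K c u w := by
    conv_lhs => rw [← hN]
    refine (State.sum_single fun s => (N * edgesValue K [c]) s s).trans ?_
    refine Finset.sum_congr rfl fun u _ => ?_
    refine (State.sum_single fun s =>
      N (State.single u) s * edgesValue K [c] s (State.single u)).trans ?_
    refine Finset.sum_congr rfl fun w _ => congrArg (HMul.hMul _) ((mul_one _).trans ?_)
    exact congrFun (congrFun (symmetrizer_transpose c) u) w
  have hrow : ∀ t, (cupStrands K c * J) i t =
      ∑ u, ∑ v, cupStrands K c i (State.pair u (v ∘ Fin.revPerm)) *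
        J (State.pair u (v ∘ Fin.revPerm)) t := fun t => by
    rw [Matrix.mul_apply, State.sum_pair]
    exact Finset.sum_congr rfl fun u _ => (sum_comp_rev fun v =>
      cupStrands K c i (State.pair u v) * J (State.pair u v) t).symm
  have hsum : (cupStrands K c * J * capStrands K c) i j =
      ∑ w, ∑ x, (cupStrands K c * J) i (State.pair w (x ∘ Fin.revPerm)) *
        capStrands K c (State.pair w (x ∘ Fin.revPerm)) j := by
    rw [Matrix.mul_apply, State.sum_pair]
    exact Finset.sum_congr rfl fun w _ => (sum_comp_rev fun x =>
      (cupStrands K c * J) i (State.pair w x) * capStrands K c (State.pair w x) j).symm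
  rw [htr, ← hW, hsum, Finset.sum_comm (s := Finset.univ (α := Fin c → Fin 2)) (f := fun u w =>
    N (State.single u) (State.single w) * (_ : Matrix _ _ K) u w),
    Finset.mul_sum]
  refine Finset.sum_congr rfl fun w _ => ?_
  simp only [hrow, hcup, hcap, hmid, Matrix.mul_apply, Matrix.transpose_apply, Finset.sum_mul,
    Finset.mul_sum]
  rw [Finset.sum_comm]
  refine Finset.sum_congr rfl fun u _ => Finset.sum_congr rfl fun x _ =>
    Finset.sum_congr rfl fun v _ => ?_
  ring

theorem chromatic_thetaNet [CharZero K] {a b c : ℕ} (h : Admissible a b c) :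
    (thetaNet a b c h).chromatic K = (-1) ^ c * ((-1) ^ strands a b c *
      ∑ s, ∑ w, (Net.merge a b c h).eval K s w ^ 2) := by
  obtain ⟨S, hS⟩ : ∃ S, S = (Net.split a b c h).eval K := ⟨_, rfl⟩
  obtain ⟨M, hM⟩ : ∃ M, M = (Net.merge a b c h).eval K := ⟨_, rfl⟩
  -- The type is given with `[c, c]` for `[c] ++ [c]`; the two agree by definition, but not
  -- syntactically.
  obtain ⟨JS, hJS⟩ : ∃ J : Matrix (State [c, c]) (State [a, b, c]) K,
    J = juxtapose S (edgesValue K [c]) := ⟨_, rfl⟩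
  obtain ⟨JM, hJM⟩ : ∃ J : Matrix (State [a, b, c]) (State [c, c]) K,
    J = juxtapose M (edgesValue K [c]) := ⟨_, rfl⟩
  have h1 : edgesValue K [c, c] * JS = JS := by
    subst hJS hS
    exact edgesValue_mul_eval (Net.beside (Net.split a b c h) (Net.edges [c]))
  have h2 : JM * edgesValue K [c, c] = JM := by
    subst hJM hM
    exact eval_mul_edgesValue (Net.beside (Net.merge a b c h) (Net.edges [c]))
  have h3 : JS * JM = juxtapose (S * M) (edgesValue K [c]) := by
    subst hJS hJM
    exact (juxtapose_mul S (edgesValue K [c]) M (edgesValue K [c])).trans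
      (congrArg _ (edgesValue_mul_self [c]))
  have h4 : (thetaNet a b c h).eval K = cupStrands K c * (JS * JM) * capStrands K c := by
    have : (thetaNet a b c h).eval K = (cupStrands K c * edgesValue K [c, c]) *
        (JS * (JM * (edgesValue K [c, c] * capStrands K c))) := by
      subst hJS hJM hS hM
      rfl
    rw [this, ← Matrix.mul_assoc JM, h2, Matrix.mul_assoc (cupStrands K c),
      ← Matrix.mul_assoc (edgesValue K [c, c]), h1]
    simp only [Matrix.mul_assoc]
  have hN : S * M * edgesValue K [c] = S * M := by
    rw [Matrix.mul_assoc, hM, eval_mul_edgesValue]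
  refine (congrFun (congrFun h4 ()) ()).trans
    ((cupStrands_mul_mul_capStrands hN h3 () ()).trans ?_)
  rw [hS, eval_split_eq, ← hM, Matrix.smul_mul, Matrix.trace_smul, smul_eq_mul,
    Matrix.trace, Finset.sum_comm]
  simp only [Matrix.diag_apply, Matrix.mul_apply, Matrix.transpose_apply, sq]

theorem map_symmetrizer {L : Type*} [Field L] (f : K →+* L) (n : ℕ) :
    (symmetrizer K n).map f = symmetrizer L n := by
  ext s t
  simp [symmetrizer]

theorem map_edgesValue {L : Type*} [Field L] (f : K →+* L) (l : List ℕ) :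
    (edgesValue K l).map f = edgesValue L l := by
  induction l with
  | nil =>
    ext s t
    exact map_one f
  | cons a l ih =>
    ext s t
    exact (map_mul f _ _).trans (congrArg₂ (· * ·)
      (congrFun (congrFun (map_symmetrizer f a) s.1) t.1) (congrFun (congrFun ih s.2) t.2))

theorem map_mergeStrands {L : Type*} [Field L] (f : K →+* L) {a b c : ℕ}
    (h : Admissible a b c) : (mergeStrands K h).map f = mergeStrands L h := by
  have hω : ∀ i j, f (omega K i j) = omega L i j := fun i j => by
    fin_cases i <;> fin_cases j <;> simp [omega]
  ext s t
  simp [mergeStrands, vertexStrands, delta, Matrix.one_apply, apply_ite f, hω]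

theorem map_eval_merge {L : Type*} [Field L] (f : K →+* L) {a b c : ℕ} (h : Admissible a b c) :
    ((Net.merge a b c h).eval K).map f = (Net.merge a b c h).eval L := by
  simp only [Net.eval, Matrix.map_mul, map_edgesValue, map_mergeStrands]

/-- A sum of nonzero squares may vanish in `K`, so positivity is proved over `ℚ` and transported
along `ℚ → K`. -/
theorem chromatic_thetaNet_ne_zero [CharZero K] {a b c : ℕ} (h : Admissible a b c) :
    (thetaNet a b c h).chromatic K ≠ 0 := by
  have hK : ∑ s, ∑ w, (Net.merge a b c h).eval K s w ^ 2 =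
      ((∑ s, ∑ w, (Net.merge a b c h).eval ℚ s w ^ 2 : ℚ) : K) := by
    rw [← map_eval_merge (Rat.castHom K) h]
    push_cast
    rfl
  rw [chromatic_thetaNet, hK]
  refine mul_ne_zero (pow_ne_zero _ (neg_ne_zero.2 one_ne_zero))
    (mul_ne_zero (pow_ne_zero _ (neg_ne_zero.2 one_ne_zero)) (Rat.cast_ne_zero.2 (ne_of_gt ?_)))
  refine Finset.sum_pos' (fun s _ => Finset.sum_nonneg fun w _ => sq_nonneg _)
    ⟨State.pair (fun _ => 0) fun _ => 1, Finset.mem_univ _, ?_⟩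
  exact Finset.sum_pos' (fun w _ => sq_nonneg _)
    ⟨State.single (stepState (strands a c b) c), Finset.mem_univ _,
      sq_pos_of_ne_zero (eval_merge_apply_stepState_ne_zero h)⟩

/-- The two networks differ only by the triangle in place of the upper vertex, and evaluation is
linear in that piece. -/
theorem chromatic_tetNet_eq {a b c A B C : ℕ} (h : Admissible a b c) (ha : Admissible a B C)
    (hb : Admissible A b C) (hc : Admissible A B c) {k : K}
    (hk : (triangleNet a b c A B C ha hb hc).eval K = k • (Net.merge a b c h).eval K) :
    (tetNet A B C a b c h ha hb hc).chromatic K = k * (thetaNet a b c h).chromatic K := by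
  have hj := juxtapose_smul_left k ((Net.merge a b c h).eval K) (edgesValue K [c])
  rw [← hk] at hj
  obtain ⟨JT, hJT⟩ : ∃ J : Matrix (State [a, b, c]) (State [c, c]) K,
    J = juxtapose ((triangleNet a b c A B C ha hb hc).eval K) (edgesValue K [c]) := ⟨_, rfl⟩
  obtain ⟨JM, hJM⟩ : ∃ J : Matrix (State [a, b, c]) (State [c, c]) K,
    J = juxtapose ((Net.merge a b c h).eval K) (edgesValue K [c]) := ⟨_, rfl⟩
  obtain ⟨JS, hJS⟩ : ∃ J : Matrix (State [c, c]) (State [a, b, c]) K,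
    J = juxtapose ((Net.split a b c h).eval K) (edgesValue K [c]) := ⟨_, rfl⟩
  have hj' : JT = k • JM := hJT.trans (hj.trans (congrArg _ hJM.symm))
  have hθ : (thetaNet a b c h).eval K =
      (Net.cup c).eval K * (JS * (JM * (Net.cap c).eval K)) := by
    subst hJS hJM
    rfl
  have h1 : (tetNet A B C a b c h ha hb hc).eval K = k • (thetaNet a b c h).eval K := by
    have : (tetNet A B C a b c h ha hb hc).eval K =
        (Net.cup c).eval K * (JS * (JT * (Net.cap c).eval K)) := by
      subst hJS hJT
      rfl
    rw [this, hj', hθ, Matrix.smul_mul, Matrix.mul_smul, Matrix.mul_smul]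
  exact congrFun (congrFun h1 ()) ()

end

end SpinNetwork

open SpinNetwork in
theorem proposition4p5 {K : Type*} [Field K] [CharZero K] (a b c A B C : ℕ)
    (h : Admissible a b c) (ha : Admissible a B C) (hb : Admissible A b C)
    (hc : Admissible A B c) :
    (thetaNet a b c h).chromatic K ≠ 0 ∧
    (triangleNet a b c A B C ha hb hc).eval K =
      ((tetNet A B C a b c h ha hb hc).chromatic K / (thetaNet a b c h).chromatic K) •
        (Net.merge a b c h).eval K ∧
    ∀ (l r : List ℕ) (lower : Net [] (l ++ ([a, b] ++ r))) (upper : Net (l ++ ([c] ++ r)) []),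
      (Net.stack lower (Net.stack (Net.beside (Net.edges l)
        (Net.beside (triangleNet a b c A B C ha hb hc) (Net.edges r))) upper)).chromatic K =
      ((tetNet A B C a b c h ha hb hc).chromatic K / (thetaNet a b c h).chromatic K) *
        (Net.stack lower (Net.stack (Net.beside (Net.edges l)
          (Net.beside (Net.merge a b c h) (Net.edges r))) upper)).chromatic K := by
  have hθ := chromatic_thetaNet_ne_zero (K := K) h
  obtain ⟨k, hk⟩ := (isInvariant_triangleNet (K := K) ha hb hc).exists_eq_smul_merge h
    (edgesValue_mul_eval _) (eval_mul_edgesValue _)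
  rw [chromatic_tetNet_eq h ha hb hc hk, mul_div_cancel_right₀ _ hθ]
  refine ⟨hθ, hk, fun l r lower upper => ?_⟩
  -- `Net.eval.eq_7` is the equation for `stack`; with `eval_beside` it exposes the fragment, whose
  -- scalar then moves out by linearity.
  simp only [Net.chromatic, Net.eval.eq_7, eval_beside, hk, juxtapose_smul_left,
    juxtapose_smul_right, Matrix.smul_mul, Matrix.mul_smul]
  rfl
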